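/- Let $n\ge 0$, let $\mathbb T^n=\mathbb R^n/\mathbb Z^n$, and let $\sigma:\mathbb R^n\to[0,\infty)$ be an anisotropy, i.e. a convex, positively one-homogeneous function with $\sigma(p)>0$ for $p\neq 0$. Put $\sigma^\circ(x)=\sup\{x\cdot p : \sigma(p)\le 1\}$, and let $\mathcal E:L^2(\mathbb T^n)\to[0,+\infty]$ be the anisotropic total variation energy $$\mathcal E(u)=\sup\Big\{-\int_{\mathbb T^n}u\,\operatorname{div}z\,dx \;:\; z\in C^1(\mathbb T^n;\mathbb R^n),\ \sigma^\circ(z)\le 1 \text{ on } \mathbb T^n\Big\}.$$ For a functional $F:H\to(-\infty,+\infty]$, finite somewhere, on a real Hilbert space $H$, write $\partial F(u)=\{v\in H : F(w)\ge F(u)+(v,w-u)\ \text{for all } w\in H\}$; this is used for $\mathcal E$ on $L^2(\mathbb T^n)$ and for $\sigma$ on $\mathbb R^n$. Let $u:\mathbb T^n\to\mathbb R$ be Lipschitz continuous and let $v\in L^2(\mathbb T^n)$. Then the following are equivalent: 1. $v\in\partial\mathcal E(u)$; 2. there exists a vector field $z\in L^\infty(\mathbb T^n;\mathbb R^n)$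 with $v=-\operatorname{div}z$ in the sense of distributions, i.e. $\int_{\mathbb T^n} v\varphi\,dx=\int_{\mathbb T^n} z\cdot\nabla\varphi\,dx$ for all $\varphi\in C^\infty(\mathbb T^n)$, such that $z(x)\in\partial\sigma(\nabla u(x))$ for almost every $x\in\mathbb T^n$. -/

import Mathlib

open MeasureTheory
open scoped ENNReal ContDiff

noncomputable section

/-- An anisotropy on `ℝⁿ`: a nonnegative, convex, positively one-homogeneous function that is
positive outside the origin. -/
structure IsAnisotropy {n : ℕ} (σ : EuclideanSpace ℝ (Fin n) → ℝ) : Prop where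
  nonneg : ∀ p, 0 ≤ σ p
  pos_homogeneous : ∀ (t : ℝ) (p : EuclideanSpace ℝ (Fin n)), 0 < t → σ (t • p) = t * σ p
  convex : ConvexOn ℝ Set.univ σ
  pos : ∀ p, p ≠ 0 → 0 < σ p

/-- The support function `σ°(x) = sup {x · p | σ p ≤ 1}` of the Frank diagram `{σ ≤ 1}`.
For an anisotropy the Frank diagram is compact and contains `0`, so the supremum is that of a
nonempty bounded set. -/
def polarAnisotropy {n : ℕ} (σ : EuclideanSpace ℝ (Fin n) → ℝ) (x : EuclideanSpace ℝ (Fin n)) :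
    ℝ :=
  sSup ((fun p => inner ℝ x p) '' {p | σ p ≤ 1})

/-- The subdifferential `∂F(u)` of an extended-real-valued functional on a real inner product
space: all `v` with `F(w) ≥ F(u) + (v, w - u)` for every `w`. (If `F ≥ 0` is finite somewhere, it
is empty wherever `F(u) = +∞`.) -/
def subdifferential {H : Type*} [NormedAddCommGroup H] [InnerProductSpace ℝ H] (F : H → EReal)
    (u : H) : Set H :=
  {v | ∀ w, F u + ((inner ℝ v (w - u) : ℝ) : EReal) ≤ F w}

/-- The quotient map `ℝⁿ → 𝕋ⁿ = ℝⁿ / ℤⁿ`. -/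
def torusProj {n : ℕ} (x : EuclideanSpace ℝ (Fin n)) : UnitAddTorus (Fin n) :=
  fun i => ((x i : ℝ) : UnitAddCircle)

/-- `f : 𝕋ⁿ → F` is of class `C^k`: its periodic lift to `ℝⁿ` is. -/
def TorusContDiff {n : ℕ} {F : Type*} [NormedAddCommGroup F] [NormedSpace ℝ F] (k : WithTop ℕ∞)
    (f : UnitAddTorus (Fin n) → F) : Prop :=
  ContDiff ℝ k (fun x : EuclideanSpace ℝ (Fin n) => f (torusProj x))

/-- The derivative at `x` of a map on the torus, computed in the chart `h ↦ x + h`, `h ∈ ℝⁿ`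
near `0`. -/
def torusFDeriv {n : ℕ} {F : Type*} [NormedAddCommGroup F] [NormedSpace ℝ F]
    (f : UnitAddTorus (Fin n) → F) (x : UnitAddTorus (Fin n)) :
    EuclideanSpace ℝ (Fin n) →L[ℝ] F :=
  fderiv ℝ (fun h : EuclideanSpace ℝ (Fin n) => f (x + torusProj h)) 0

/-- The gradient of `u : 𝕋ⁿ → ℝ` at `x`: the vector with entries the partial derivatives of `u`. -/
def torusGrad {n : ℕ} (u : UnitAddTorus (Fin n) → ℝ) (x : UnitAddTorus (Fin n)) :
    EuclideanSpace ℝ (Fin n) :=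
  WithLp.toLp 2 fun i => torusFDeriv u x (EuclideanSpace.single i 1)

/-- The classical divergence `∑ᵢ ∂ᵢ zᵢ` of a vector field on the torus. -/
def torusDiv {n : ℕ} (z : UnitAddTorus (Fin n) → EuclideanSpace ℝ (Fin n))
    (x : UnitAddTorus (Fin n)) : ℝ :=
  ∑ i, torusFDeriv z x (EuclideanSpace.single i 1) i

/-- The Hilbert space `L²(𝕋ⁿ)` of real functions, for the Lebesgue (unit-mass Haar) measure. -/
abbrev TorusL2 (n : ℕ) : Type :=
  Lp ℝ 2 (volume : Measure (UnitAddTorus (Fin n)))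

/-- The anisotropic total variation energy on `L²(𝕋ⁿ)`:
`E(u) = sup {-∫ u div z | z ∈ C¹(𝕋ⁿ, ℝⁿ), σ°(z) ≤ 1}`, with values in `[0, +∞]`. -/
def anisotropicTV {n : ℕ} (σ : EuclideanSpace ℝ (Fin n) → ℝ) (u : TorusL2 n) : EReal :=
  ⨆ z ∈ {z : UnitAddTorus (Fin n) → EuclideanSpace ℝ (Fin n) |
      TorusContDiff 1 z ∧ ∀ x, polarAnisotropy σ (z x) ≤ 1},
    ((-∫ x, u x * torusDiv z x : ℝ) : EReal)

/-- `v = -div z` in the sense of distributions on the torus: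
`∫ v φ = ∫ z · ∇φ` for all `φ ∈ C^∞(𝕋ⁿ)`. -/
def IsNegDistribDiv {n : ℕ} (v : UnitAddTorus (Fin n) → ℝ)
    (z : UnitAddTorus (Fin n) → EuclideanSpace ℝ (Fin n)) : Prop :=
  ∀ φ : UnitAddTorus (Fin n) → ℝ, TorusContDiff ∞ φ →
    ∫ x, v x * φ x = ∫ x, inner ℝ (z x) (torusGrad φ x)

/-- A Lipschitz function on the (compact) torus is square integrable. -/
theorem LipschitzWith.memLp_torus {n : ℕ} {K : NNReal} {u : UnitAddTorus (Fin n) → ℝ}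
    (hu : LipschitzWith K u) : MemLp u 2 (volume : Measure (UnitAddTorus (Fin n))) :=
  hu.continuous.memLp_of_hasCompactSupport (HasCompactSupport.of_compactSpace u)

end

/-! The energy is the support function in `L²` of the convex set `D` of divergences `-div z`, with
`z` a `C¹` field valued in the polar ball `W = {q | q · p ≤ σ p for all p}`. It is therefore
one-homogeneous. Where it is finite, `v ∈ ∂E(u)` forces `E(u) = (v, u)` and `(v, w) ≤ E(w)` for all
`w` (`inner_eq_of_mem_subdifferential_anisotropicTV`).

By Hahn–Banach the inequality puts `v` in the closure of `D`. The approximating fields are uniformly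
bounded because `W` is, and a weak `L²` limit is a field `z` valued in `W` with `v = -div z`
(`exists_field_of_le_anisotropicTV`). The equality then reads `E(u) = ∫ z · ∇u`. Since every bounded
measurable field in `W` is a competitor for Lipschitz `u`, replacing `z` by a constant `q ∈ W` on a
measurable set cannot increase this integral. Hence `q · ∇u ≤ z · ∇u` a.e., and maximizing over `q`
gives `z · ∇u = σ(∇u)`, which for `z ∈ W` means `z ∈ ∂σ(∇u)`
(`ae_mem_subdifferential_of_anisotropicTV_le`).

Conversely, mollifying `z` keeps it in `W` and commutes with the divergence, so `(v, w) ≤ E(w)`.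
Every admissible `ζ` satisfies `ζ · ∇u ≤ σ(∇u) = z · ∇u`, so `E(u) ≤ (v, u)`. Subtracting gives the
subgradient inequality. -/

open Filter Topology

/-! ### Calculus on the torus through periodic lifts -/

section TorusCalculus

variable {n : ℕ} {F : Type*} [NormedAddCommGroup F] [NormedSpace ℝ F]

theorem torusProj_add (x y : EuclideanSpace ℝ (Fin n)) :
    torusProj (x + y) = torusProj x + torusProj y := by
  ext i; simp [torusProj]

theorem torusProj_neg (x : EuclideanSpace ℝ (Fin n)) :
    torusProj (-x) = -torusProj x := by
  ext i; simp [torusProj]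

theorem torusProj_zero : torusProj (0 : EuclideanSpace ℝ (Fin n)) = 0 := by
  ext i; simp [torusProj]

/-- Openness of the circle projection is what lets the quotient property pass to products.
Continuity on the torus can then be checked on lifts. -/
theorem isOpenQuotientMap_torusProj :
    IsOpenQuotientMap (torusProj : EuclideanSpace ℝ (Fin n) → UnitAddTorus (Fin n)) :=
  (IsOpenQuotientMap.piMap fun _ : Fin n =>
    (QuotientAddGroup.isOpenQuotientMap_mk : IsOpenQuotientMap ((↑) : ℝ → UnitAddCircle))).comp
    (EuclideanSpace.equiv (Fin n) ℝ).toHomeomorph.isOpenQuotientMap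

theorem continuous_torusProj :
    Continuous (torusProj : EuclideanSpace ℝ (Fin n) → UnitAddTorus (Fin n)) :=
  isOpenQuotientMap_torusProj.continuous

theorem torusProj_surjective :
    Function.Surjective (torusProj : EuclideanSpace ℝ (Fin n) → UnitAddTorus (Fin n)) :=
  isOpenQuotientMap_torusProj.surjective

theorem lipschitzWith_torusProj :
    LipschitzWith 1 (torusProj : EuclideanSpace ℝ (Fin n) → UnitAddTorus (Fin n)) := by
  refine LipschitzWith.of_dist_le_mul fun x y => ?_
  rw [NNReal.coe_one, one_mul, dist_pi_le_iff dist_nonneg]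
  intro i
  rw [dist_eq_norm, dist_eq_norm]
  have h : torusProj x i - torusProj y i = (((x - y) i : ℝ) : UnitAddCircle) := by
    simp [torusProj]
  rw [h]
  refine le_trans ?_ (PiLp.norm_apply_le (x - y) i)
  exact QuotientAddGroup.norm_mk_le_norm

theorem torusFDeriv_torusProj (f : UnitAddTorus (Fin n) → F) (x : EuclideanSpace ℝ (Fin n)) :
    torusFDeriv f (torusProj x) = fderiv ℝ (fun y => f (torusProj y)) x := by
  unfold torusFDeriv
  simp_rw [← torusProj_add]
  rw [fderiv_comp_add_left (f := fun y => f (torusProj y)), add_zero]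

/-- A property of points of the torus that holds at almost every point of `ℝⁿ` after lifting holds
almost everywhere. -/
theorem ae_torus_of_ae_lift {P : UnitAddTorus (Fin n) → Prop}
    (h : ∀ᵐ x : EuclideanSpace ℝ (Fin n), P (torusProj x)) : ∀ᵐ t, P t := by
  have h1 : ∀ᵐ x : Fin n → ℝ, P (fun i => (x i : UnitAddCircle)) :=
    (PiLp.volume_preserving_toLp (Fin n)).quasiMeasurePreserving.ae h
  -- The half-open unit cube is a fundamental domain, identified with the torus by a
  -- measure-preserving map.
  have hm : MeasurableSet {x : Fin n → ℝ |
      ∀ i, x i ∈ Set.Ioc ((0 : Fin n → ℝ) i) ((0 : Fin n → ℝ) i + 1)} :=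
    MeasurableSet.univ_pi' fun _ => measurableSet_Ioc
  have h2 := ae_restrict_of_ae (s := {x : Fin n → ℝ |
      ∀ i, x i ∈ Set.Ioc ((0 : Fin n → ℝ) i) ((0 : Fin n → ℝ) i + 1)}) h1
  rw [← map_comap_subtype_coe hm, (MeasurableEmbedding.subtype_coe hm).ae_map_iff] at h2
  have h3 := (UnitAddTorus.measurePreserving_equivPiIoc
    (d := Fin n) 0).quasiMeasurePreserving.ae h2
  have h4 : (volume : Measure (UnitAddTorus (Fin n))) =
      Measure.pi fun _ => (AddCircle.haarAddCircle : Measure UnitAddCircle) := by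
    simp [volume_pi, AddCircle.volume_eq_smul_haarAddCircle]
  rw [h4]
  refine Eventually.mono h3 fun t ht => ?_
  convert ht using 1
  ext i
  simp

/-- **Rademacher's theorem** on the torus. -/
theorem ae_differentiableAt_torus [FiniteDimensional ℝ F] {f : UnitAddTorus (Fin n) → F}
    {K : NNReal} (hf : LipschitzWith K fun x : EuclideanSpace ℝ (Fin n) => f (torusProj x)) :
    ∀ᵐ t, DifferentiableAt ℝ (fun h : EuclideanSpace ℝ (Fin n) => f (t + torusProj h)) 0 := by
  refine ae_torus_of_ae_lift ?_
  filter_upwards [hf.ae_differentiableAt (μ := volume)] with x hx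
  simp_rw [← torusProj_add]
  refine DifferentiableAt.comp (0 : EuclideanSpace ℝ (Fin n)) (g := fun y => f (torusProj y))
    (f := fun h => x + h) ?_ (by fun_prop)
  simpa using hx

theorem continuous_of_continuous_lift {G : Type*} [TopologicalSpace G]
    {f : UnitAddTorus (Fin n) → G}
    (hf : Continuous fun x : EuclideanSpace ℝ (Fin n) => f (torusProj x)) : Continuous f :=
  isOpenQuotientMap_torusProj.isQuotientMap.continuous_iff.2 hf

theorem TorusContDiff.continuous {k : WithTop ℕ∞} {f : UnitAddTorus (Fin n) → F}
    (hf : TorusContDiff k f) : Continuous f :=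
  continuous_of_continuous_lift (ContDiff.continuous hf)

theorem TorusContDiff.continuous_torusFDeriv {f : UnitAddTorus (Fin n) → F}
    (hf : TorusContDiff 1 f) : Continuous (torusFDeriv f) := by
  refine continuous_of_continuous_lift ?_
  simp_rw [torusFDeriv_torusProj]
  exact hf.continuous_fderiv one_ne_zero

theorem norm_torusFDeriv_le {f : UnitAddTorus (Fin n) → F} {K : NNReal}
    (hf : LipschitzWith K fun x : EuclideanSpace ℝ (Fin n) => f (torusProj x))
    (t : UnitAddTorus (Fin n)) : ‖torusFDeriv f t‖ ≤ K := by
  obtain ⟨x, rfl⟩ := torusProj_surjective t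
  rw [torusFDeriv_torusProj]
  exact norm_fderiv_le_of_lipschitz ℝ hf

theorem TorusContDiff.exists_norm_torusFDeriv_le {f : UnitAddTorus (Fin n) → F}
    (hf : TorusContDiff 1 f) : ∃ C : NNReal, ∀ t, ‖torusFDeriv f t‖ ≤ C := by
  obtain ⟨C, hC⟩ := isCompact_univ.exists_bound_of_continuousOn
    hf.continuous_torusFDeriv.continuousOn
  exact ⟨C.toNNReal, fun t => (hC t (Set.mem_univ t)).trans (Real.le_coe_toNNReal C)⟩

theorem TorusContDiff.exists_lipschitzWith_lift {f : UnitAddTorus (Fin n) → F}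
    (hf : TorusContDiff 1 f) :
    ∃ C : NNReal, LipschitzWith C fun x : EuclideanSpace ℝ (Fin n) => f (torusProj x) := by
  obtain ⟨C, hC⟩ := hf.exists_norm_torusFDeriv_le
  refine ⟨C, lipschitzWith_of_nnnorm_fderiv_le (𝕜 := ℝ)
    (ContDiff.differentiable hf one_ne_zero) fun x => ?_⟩
  rw [← torusFDeriv_torusProj]
  exact hC _

theorem LipschitzWith.lift_torus {X : Type*} [PseudoEMetricSpace X]
    {f : UnitAddTorus (Fin n) → X} {K : NNReal} (hf : LipschitzWith K f) :
    LipschitzWith K fun x : EuclideanSpace ℝ (Fin n) => f (torusProj x) := by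
  simpa [Function.comp_def] using hf.comp lipschitzWith_torusProj

theorem measurable_torusFDeriv [CompleteSpace F] {f : UnitAddTorus (Fin n) → F}
    (hf : Continuous f) : Measurable (torusFDeriv f) := by
  have : Continuous (Function.uncurry fun (t : UnitAddTorus (Fin n))
      (h : EuclideanSpace ℝ (Fin n)) => f (t + torusProj h)) :=
    hf.comp (continuous_fst.add (continuous_torusProj.comp continuous_snd))
  exact (measurable_fderiv_with_param ℝ this).comp (measurable_id.prodMk measurable_const)

/-- Integration by parts on the torus for functions with Lipschitz lifts. -/
theorem integral_mul_torusFDeriv {f g : UnitAddTorus (Fin n) → ℝ} {K L : NNReal}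
    (hf : LipschitzWith K fun x : EuclideanSpace ℝ (Fin n) => f (torusProj x))
    (hg : LipschitzWith L fun x : EuclideanSpace ℝ (Fin n) => g (torusProj x))
    (e : EuclideanSpace ℝ (Fin n)) :
    ∫ t, f t * torusFDeriv g t e = -∫ t, g t * torusFDeriv f t e := by
  -- Difference quotients converge a.e. by Rademacher and are dominated by `L * ‖e‖`.
  have key : ∀ {f g : UnitAddTorus (Fin n) → ℝ} {K L : NNReal}
      (_ : LipschitzWith K fun x : EuclideanSpace ℝ (Fin n) => f (torusProj x))
      (_ : LipschitzWith L fun x : EuclideanSpace ℝ (Fin n) => g (torusProj x))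
      (e : EuclideanSpace ℝ (Fin n)),
      Tendsto (fun s : ℝ => ∫ t, f t * (s⁻¹ * (g (t + torusProj (s • e)) - g t))) (𝓝[>] 0)
        (𝓝 (∫ t, f t * torusFDeriv g t e)) := by
    intro f g K L hf hg e
    have hfc : Continuous f := continuous_of_continuous_lift hf.continuous
    have hgc : Continuous g := continuous_of_continuous_lift hg.continuous
    refine tendsto_integral_filter_of_dominated_convergence (fun t => |f t| * (L * ‖e‖)) ?_ ?_ ?_ ?_
    · refine Eventually.of_forall fun s => Continuous.aestronglyMeasurable ?_
      fun_prop
    · filter_upwards [self_mem_nhdsWithin] with s (hs : 0 < s)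
      refine Eventually.of_forall fun t => ?_
      rw [norm_mul, Real.norm_eq_abs]
      refine mul_le_mul_of_nonneg_left ?_ (abs_nonneg _)
      rw [norm_mul]
      obtain ⟨x, rfl⟩ := torusProj_surjective t
      rw [← torusProj_add, norm_inv, inv_mul_le_iff₀ (norm_pos_iff.2 hs.ne')]
      have := hg.dist_le_mul (x + s • e) x
      rw [dist_eq_norm, dist_eq_norm, add_sub_cancel_left, norm_smul] at this
      linarith
    · exact (Continuous.integrable_of_hasCompactSupport (by fun_prop)
        (HasCompactSupport.of_compactSpace _))
    · filter_upwards [ae_differentiableAt_torus hg] with t ht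
      have := (ht.hasFDerivAt.hasLineDerivAt e).tendsto_slope_zero_right
      simp only [zero_add, torusProj_zero, add_zero, smul_eq_mul] at this
      exact this.const_mul _
  have hfc : Continuous f := continuous_of_continuous_lift hf.continuous
  have hgc : Continuous g := continuous_of_continuous_lift hg.continuous
  -- Translation invariance moves the shift by `s • e` from `g` to a shift by `-s • e` on `f`. Both
  -- quotient integrals agree before the limit, so no product rule is needed.
  have h1 := key hf hg e
  have h2 := (key hg hf (-e)).congr' (f₂ := fun s : ℝ => 
    ∫ t, f t * (s⁻¹ * (g (t + torusProj (s • e)) - g t))) ?_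
  · have := tendsto_nhds_unique h1 h2
    rw [this, ← integral_neg]
    simp
  · refine Eventually.of_forall fun s => ?_
    have hi : ∀ {h : UnitAddTorus (Fin n) → ℝ}, Continuous h → Integrable h := fun hc =>
      Continuous.integrable_of_hasCompactSupport hc (HasCompactSupport.of_compactSpace _)
    set a := torusProj (s • e) with ha
    have ha' : torusProj (s • -e) = -a := by rw [smul_neg, torusProj_neg]
    simp only [ha']
    have h3 : ∫ t, f t * g (t + a) = ∫ t, g t * f (t + -a) := by
      rw [← integral_add_right_eq_self (fun t => g t * f (t + -a)) a]
      simp [mul_comm]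
    have e1 : ∀ t, f t * (s⁻¹ * (g (t + a) - g t)) = s⁻¹ * (f t * g (t + a) - f t * g t) :=
      fun t => by ring
    have e2 : ∀ t, g t * (s⁻¹ * (f (t + -a) - f t)) = s⁻¹ * (g t * f (t + -a) - f t * g t) :=
      fun t => by ring
    simp only [← ha, e1, e2, integral_const_mul]
    rw [integral_sub (hi (by fun_prop)) (hi (by fun_prop)),
      integral_sub (hi (by fun_prop)) (hi (by fun_prop)), h3]

end TorusCalculus

/-! ### Gradient, divergence and integration by parts -/

section Divergence

variable {n : ℕ}

theorem TorusContDiff.torusFDeriv_apply {z : UnitAddTorus (Fin n) → EuclideanSpace ℝ (Fin n)}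
    (hz : TorusContDiff 1 z) (t : UnitAddTorus (Fin n)) (e : EuclideanSpace ℝ (Fin n))
    (i : Fin n) : torusFDeriv (fun t => z t i) t e = torusFDeriv z t e i := by
  obtain ⟨x, rfl⟩ := torusProj_surjective t
  rw [torusFDeriv_torusProj, torusFDeriv_torusProj]
  have h := ((ContDiff.differentiable hz one_ne_zero) x).hasFDerivAt
  have h2 := ((EuclideanSpace.proj i : EuclideanSpace ℝ (Fin n) →L[ℝ] ℝ).hasFDerivAt).comp x h
  have h3 : fderiv ℝ (fun y => z (torusProj y) i) x = _ := h2.fderiv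
  rw [h3]
  rfl

theorem TorusContDiff.apply {k : WithTop ℕ∞}
    {z : UnitAddTorus (Fin n) → EuclideanSpace ℝ (Fin n)}
    (hz : TorusContDiff k z) (i : Fin n) : TorusContDiff k (fun t => z t i) :=
  ContDiff.comp (EuclideanSpace.proj i : EuclideanSpace ℝ (Fin n) →L[ℝ] ℝ).contDiff hz

theorem Continuous.integrable_torus {F : Type*} [NormedAddCommGroup F]
    {f : UnitAddTorus (Fin n) → F} (hf : Continuous f) : Integrable f :=
  hf.integrable_of_hasCompactSupport (HasCompactSupport.of_compactSpace f)

theorem TorusContDiff.continuous_torusDiv {z : UnitAddTorus (Fin n) → EuclideanSpace ℝ (Fin n)}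
    (hz : TorusContDiff 1 z) : Continuous (torusDiv z) := by
  have := hz.continuous_torusFDeriv
  unfold torusDiv
  fun_prop

theorem measurable_torusGrad {u : UnitAddTorus (Fin n) → ℝ} (hu : Continuous u) :
    Measurable (torusGrad u) := by
  refine (WithLp.measurable_toLp 2 _).comp (measurable_pi_lambda _ fun i => ?_)
  exact (ContinuousLinearMap.apply ℝ ℝ
    (EuclideanSpace.single i (1 : ℝ))).continuous.measurable.comp (measurable_torusFDeriv hu)

theorem inner_torusGrad (u : UnitAddTorus (Fin n) → ℝ) (t : UnitAddTorus (Fin n))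
    (p : EuclideanSpace ℝ (Fin n)) : inner ℝ p (torusGrad u t) = torusFDeriv u t p := by
  have : p = ∑ i, p i • EuclideanSpace.single i (1 : ℝ) := by
    simpa using ((EuclideanSpace.basisFun (Fin n) ℝ).sum_repr p).symm
  conv_rhs => rw [this]
  simp [PiLp.inner_apply, torusGrad, mul_comm]

/-- Applying the derivative to the gradient `g` itself gives `‖g‖² ≤ K ‖g‖`. -/
theorem norm_torusGrad_le {u : UnitAddTorus (Fin n) → ℝ} {K : NNReal}
    (hu : LipschitzWith K fun x : EuclideanSpace ℝ (Fin n) => u (torusProj x))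
    (t : UnitAddTorus (Fin n)) : ‖torusGrad u t‖ ≤ K := by
  have h := (torusFDeriv u t).le_of_opNorm_le (norm_torusFDeriv_le hu t) (torusGrad u t)
  rw [← inner_torusGrad, real_inner_self_eq_norm_sq, Real.norm_eq_abs, abs_of_nonneg (sq_nonneg _),
    sq] at h
  rcases (norm_nonneg (torusGrad u t)).eq_or_lt with h0 | h0
  · rw [← h0]; exact K.2
  · exact le_of_mul_le_mul_right h h0

theorem memLp_top_torusGrad {u : UnitAddTorus (Fin n) → ℝ} {K : NNReal}
    (hu : LipschitzWith K fun x : EuclideanSpace ℝ (Fin n) => u (torusProj x)) :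
    MemLp (torusGrad u) ∞ (volume : Measure (UnitAddTorus (Fin n))) :=
  memLp_top_of_bound
    (measurable_torusGrad (continuous_of_continuous_lift hu.continuous)).aestronglyMeasurable K
    (Eventually.of_forall (norm_torusGrad_le hu))

/-- Integration by parts of a Lipschitz function against a `C¹` vector field. -/
theorem neg_integral_mul_torusDiv {u : UnitAddTorus (Fin n) → ℝ} {K : NNReal}
    (hu : LipschitzWith K fun x : EuclideanSpace ℝ (Fin n) => u (torusProj x))
    {z : UnitAddTorus (Fin n) → EuclideanSpace ℝ (Fin n)} (hz : TorusContDiff 1 z) :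
    -∫ t, u t * torusDiv z t = ∫ t, inner ℝ (z t) (torusGrad u t) := by
  have huc : Continuous u := continuous_of_continuous_lift hu.continuous
  have hzc := hz.continuous_torusFDeriv
  have h1 : ∀ t, inner ℝ (z t) (torusGrad u t) =
      ∑ i, z t i * torusFDeriv u t (EuclideanSpace.single i 1) := fun t => by
    simp [PiLp.inner_apply, torusGrad, mul_comm]
  have hint : ∀ i, Integrable fun t =>
      z t i * torusFDeriv u t (EuclideanSpace.single i (1 : ℝ)) := fun i => by
    refine ((hz.apply i).continuous.integrable_torus).mul_bdd (c := K) ?_ ?_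
    · exact ((ContinuousLinearMap.apply ℝ ℝ
        (EuclideanSpace.single i (1 : ℝ))).continuous.measurable.comp
          (measurable_torusFDeriv huc)).aestronglyMeasurable
    · refine Eventually.of_forall fun t => ?_
      simpa using (torusFDeriv u t).le_of_opNorm_le (norm_torusFDeriv_le hu t)
        (EuclideanSpace.single i (1 : ℝ))
  simp_rw [h1, torusDiv, Finset.mul_sum]
  rw [integral_finsetSum _ fun i _ => hint i, integral_finsetSum, ← Finset.sum_neg_distrib]
  · refine Finset.sum_congr rfl fun i _ => ?_
    obtain ⟨L, hL⟩ := (hz.apply i).exists_lipschitzWith_lift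
    rw [integral_mul_torusFDeriv hL hu]
    simp_rw [hz.torusFDeriv_apply]
  · intro i _
    exact Continuous.integrable_torus (by fun_prop)

end Divergence

/-! ### Mollification on the torus -/

section Mollification

variable {n : ℕ} {F : Type*} [NormedAddCommGroup F] [NormedSpace ℝ F]

/-- The average `x ↦ ∫ ρ(y - x) f(y) dy` of `f` on the torus with the kernel `ρ`. -/
noncomputable def torusMollify (ρ : UnitAddTorus (Fin n) → ℝ) (f : UnitAddTorus (Fin n) → F)
    (x : UnitAddTorus (Fin n)) : F :=
  ∫ y, ρ (y - x) • f y

theorem integrable_kernel_smul {ρ : UnitAddTorus (Fin n) → ℝ} (hρ : Continuous ρ)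
    {f : UnitAddTorus (Fin n) → F} (hf : Integrable f) (x : UnitAddTorus (Fin n)) :
    Integrable fun y => ρ (y - x) • f y := by
  obtain ⟨C, hC⟩ := isCompact_univ.exists_bound_of_continuousOn hρ.continuousOn
  exact hf.bdd_smul C (Continuous.aestronglyMeasurable (by fun_prop))
    (Eventually.of_forall fun y => hC _ (Set.mem_univ _))

theorem aestronglyMeasurable_smulRight_torusFDeriv {ρ : UnitAddTorus (Fin n) → ℝ}
    (hρ : TorusContDiff 1 ρ) {f : UnitAddTorus (Fin n) → F} (hf : Integrable f)
    (x : UnitAddTorus (Fin n)) :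
    AEStronglyMeasurable (fun y => (-torusFDeriv ρ (y - x)).smulRight (f y)) := by
  have hc := hρ.continuous_torusFDeriv
  have h1 : Continuous fun y => -torusFDeriv ρ (y - x) := by fun_prop
  have h2 := (ContinuousLinearMap.smulRightL ℝ (EuclideanSpace ℝ (Fin n)) F).continuous₂
  exact h2.comp_aestronglyMeasurable (h1.aestronglyMeasurable.prodMk hf.1)

/-- The derivative falls on the kernel, with a minus sign because `x` enters as `y - x`. Boundedness
of the kernel's derivative supplies the dominating function. -/
theorem hasFDerivAt_torusMollify {ρ : UnitAddTorus (Fin n) → ℝ} (hρ : TorusContDiff 1 ρ)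
    {f : UnitAddTorus (Fin n) → F} (hf : Integrable f) (x : EuclideanSpace ℝ (Fin n)) :
    HasFDerivAt (fun x => torusMollify ρ f (torusProj x))
      (∫ y, (-torusFDeriv ρ (y - torusProj x)).smulRight (f y)) x := by
  obtain ⟨C, hC⟩ := hρ.exists_norm_torusFDeriv_le
  refine hasFDerivAt_integral_of_dominated_of_fderiv_le (s := Set.univ)
    (F := fun x y => ρ (y - torusProj x) • f y)
    (F' := fun x y => (-torusFDeriv ρ (y - torusProj x)).smulRight (f y))
    (bound := fun y => C * ‖f y‖) univ_mem ?_ ?_ ?_ ?_ ?_ ?_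
  · exact Eventually.of_forall fun x => (integrable_kernel_smul hρ.continuous hf _).1
  · exact integrable_kernel_smul hρ.continuous hf _
  · exact aestronglyMeasurable_smulRight_torusFDeriv hρ hf _
  · refine Eventually.of_forall fun y x _ => ?_
    rw [ContinuousLinearMap.norm_smulRight_apply, norm_neg]
    gcongr
    exact hC _
  · exact hf.norm.const_mul _
  · refine Eventually.of_forall fun y x _ => ?_
    refine HasFDerivAt.smul_const ?_ (f y)
    obtain ⟨y, rfl⟩ := torusProj_surjective y
    have h1 : ∀ x, torusProj y - torusProj x = torusProj (y - x) := fun x => by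
      rw [sub_eq_add_neg, sub_eq_add_neg, torusProj_add, torusProj_neg]
    simp_rw [h1]
    rw [torusFDeriv_torusProj]
    have h2 := (ContDiff.differentiable hρ one_ne_zero (y - x)).hasFDerivAt
    have h3 := h2.comp x ((hasFDerivAt_id x).const_sub y)
    simpa [Function.comp_def] using h3

theorem torusContDiff_torusMollify {ρ : UnitAddTorus (Fin n) → ℝ} (hρ : TorusContDiff 1 ρ)
    {f : UnitAddTorus (Fin n) → F} (hf : Integrable f) :
    TorusContDiff 1 (torusMollify ρ f) := by
  have h := hasFDerivAt_torusMollify hρ hf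
  refine contDiff_one_iff_fderiv.2 ⟨fun x => (h x).differentiableAt, ?_⟩
  have h1 : fderiv ℝ (fun x => torusMollify ρ f (torusProj x)) = _ := funext fun x => (h x).fderiv
  rw [h1]
  obtain ⟨C, hC⟩ := hρ.exists_norm_torusFDeriv_le
  refine continuous_of_dominated (bound := fun y => C * ‖f y‖)
    (fun x => aestronglyMeasurable_smulRight_torusFDeriv hρ hf _) (fun x => ?_)
    (hf.norm.const_mul _) ?_
  · refine Eventually.of_forall fun y => ?_
    rw [ContinuousLinearMap.norm_smulRight_apply, norm_neg]
    gcongr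
    exact hC _
  · refine Eventually.of_forall fun y => ?_
    have hc := hρ.continuous_torusFDeriv
    have hp := continuous_torusProj (n := n)
    have h2 : Continuous fun x => -torusFDeriv ρ (y - torusProj x) := by fun_prop
    have h3 := (ContinuousLinearMap.smulRightL ℝ (EuclideanSpace ℝ (Fin n)) F).continuous₂
    exact h3.comp (h2.prodMk continuous_const)

theorem torusFDeriv_torusMollify {ρ : UnitAddTorus (Fin n) → ℝ} (hρ : TorusContDiff 1 ρ)
    {f : UnitAddTorus (Fin n) → F} [CompleteSpace F] (hf : Integrable f)
    (x : UnitAddTorus (Fin n)) (e : EuclideanSpace ℝ (Fin n)) :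
    torusFDeriv (torusMollify ρ f) x e = -∫ y, torusFDeriv ρ (y - x) e • f y := by
  obtain ⟨x, rfl⟩ := torusProj_surjective x
  rw [torusFDeriv_torusProj, (hasFDerivAt_torusMollify hρ hf x).fderiv,
    ContinuousLinearMap.integral_apply, ← integral_neg]
  · simp
  · obtain ⟨C, hC⟩ := hρ.exists_norm_torusFDeriv_le
    refine (hf.norm.const_mul C).mono'
      (aestronglyMeasurable_smulRight_torusFDeriv hρ hf _) (Eventually.of_forall fun y => ?_)
    rw [ContinuousLinearMap.norm_smulRight_apply, norm_neg]
    gcongr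
    exact hC _

theorem torusGrad_comp_sub (ρ : UnitAddTorus (Fin n) → ℝ) (x y : UnitAddTorus (Fin n)) :
    torusGrad (fun y => ρ (y - x)) y = torusGrad ρ (y - x) := by
  unfold torusGrad torusFDeriv
  simp_rw [add_sub_right_comm]

theorem torusContDiff_comp_sub {k : WithTop ℕ∞} {ρ : UnitAddTorus (Fin n) → F}
    (hρ : TorusContDiff k ρ) (x : UnitAddTorus (Fin n)) :
    TorusContDiff k (fun y => ρ (y - x)) := by
  obtain ⟨x, rfl⟩ := torusProj_surjective x
  have h1 : ∀ y, torusProj y - torusProj x = torusProj (y - x) := fun y => by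
    rw [sub_eq_add_neg, sub_eq_add_neg, torusProj_add, torusProj_neg]
  unfold TorusContDiff
  simp_rw [h1]
  exact ContDiff.comp (g := fun x => ρ (torusProj x)) hρ (contDiff_id.sub contDiff_const)

/-- Mollification commutes with the distributional divergence. -/
theorem torusDiv_torusMollify {ρ : UnitAddTorus (Fin n) → ℝ} (hρ : TorusContDiff ∞ ρ)
    {v : UnitAddTorus (Fin n) → ℝ} {z : UnitAddTorus (Fin n) → EuclideanSpace ℝ (Fin n)}
    (hz : Integrable z) (h : IsNegDistribDiv v z) (x : UnitAddTorus (Fin n)) :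
    torusDiv (torusMollify ρ z) x = -torusMollify ρ v x := by
  have hρ1 : TorusContDiff 1 ρ := ContDiff.of_le hρ (by exact_mod_cast le_top)
  -- The test function is the translated kernel `y ↦ ρ (y - x)`.
  have h1 := h _ (torusContDiff_comp_sub hρ x)
  have h2 : torusMollify ρ v x = ∫ y, inner ℝ (z y) (torusGrad (fun y => ρ (y - x)) y) := by
    rw [← h1]
    simp [torusMollify, mul_comm]
  rw [h2, torusDiv]
  obtain ⟨C, hC⟩ := hρ1.exists_norm_torusFDeriv_le
  have hint : ∀ i, Integrable fun y =>
      torusFDeriv ρ (y - x) (EuclideanSpace.single i (1 : ℝ)) • z y := fun i => by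
    have := hρ1.continuous_torusFDeriv
    have hc : Continuous fun y => torusFDeriv ρ (y - x) (EuclideanSpace.single i (1 : ℝ)) := by
      fun_prop
    refine hz.bdd_smul C hc.aestronglyMeasurable ?_
    refine Eventually.of_forall fun t => ?_
    simpa using (torusFDeriv ρ (t - x)).le_of_opNorm_le (hC _) (EuclideanSpace.single i (1 : ℝ))
  simp_rw [torusFDeriv_torusMollify hρ1 hz, torusGrad_comp_sub]
  have h3 : ∀ y, inner ℝ (z y) (torusGrad ρ (y - x)) =
      ∑ i, (torusFDeriv ρ (y - x) (EuclideanSpace.single i (1 : ℝ)) • z y) i := fun y => by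
    simp [PiLp.inner_apply, torusGrad]
  simp_rw [h3]
  have h4 : ∀ i, ∫ y, (torusFDeriv ρ (y - x) (EuclideanSpace.single i (1 : ℝ)) • z y) i =
      (∫ y, torusFDeriv ρ (y - x) (EuclideanSpace.single i (1 : ℝ)) • z y) i := fun i =>
    (EuclideanSpace.proj i : EuclideanSpace ℝ (Fin n) →L[ℝ] ℝ).integral_comp_comm (hint i)
  rw [integral_finsetSum]
  · simp_rw [h4]
    simp
  · exact fun i _ => (EuclideanSpace.proj i : EuclideanSpace ℝ (Fin n) →L[ℝ] ℝ).integrable_comp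
      (hint i)

end Mollification

/-! ### Convex analysis of the anisotropy -/

section Anisotropy

variable {n : ℕ} {σ : EuclideanSpace ℝ (Fin n) → ℝ}

theorem IsAnisotropy.map_zero (hσ : IsAnisotropy σ) : σ 0 = 0 := by
  have := hσ.pos_homogeneous 2 0 two_pos
  rw [smul_zero] at this
  linarith

theorem IsAnisotropy.continuous (hσ : IsAnisotropy σ) : Continuous σ :=
  continuousOn_univ.1 (hσ.convex.continuousOn isOpen_univ)

/-- Midpoint convexity at `2p` and `2q`, combined with homogeneity. -/
theorem IsAnisotropy.add_le (hσ : IsAnisotropy σ) (p q : EuclideanSpace ℝ (Fin n)) :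
    σ (p + q) ≤ σ p + σ q := by
  have h := hσ.convex.2 (Set.mem_univ ((2 : ℝ) • p)) (Set.mem_univ ((2 : ℝ) • q))
    (show (0 : ℝ) ≤ 1 / 2 by norm_num) (show (0 : ℝ) ≤ 1 / 2 by norm_num) (by norm_num)
  rw [hσ.pos_homogeneous 2 p two_pos, hσ.pos_homogeneous 2 q two_pos, smul_smul, smul_smul] at h
  norm_num at h
  linarith

theorem IsAnisotropy.exists_le_mul_norm (hσ : IsAnisotropy σ) :
    ∃ C, 0 ≤ C ∧ ∀ p, σ p ≤ C * ‖p‖ := by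
  obtain ⟨C, hC⟩ := (isCompact_sphere (0 : EuclideanSpace ℝ (Fin n)) 1).exists_bound_of_continuousOn
    hσ.continuous.continuousOn
  -- For `n = 0` the sphere is empty and `C` could be negative.
  refine ⟨max C 0, le_max_right _ _, fun p => ?_⟩
  rcases eq_or_ne p 0 with rfl | hp
  · simp [hσ.map_zero]
  have h0 : 0 < ‖p‖ := norm_pos_iff.2 hp
  have h1 := hC (‖p‖⁻¹ • p) (by simp [norm_smul, h0.ne'])
  rw [hσ.pos_homogeneous _ _ (inv_pos.2 h0), Real.norm_eq_abs] at h1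
  have h2 := (le_abs_self _).trans (h1.trans (le_max_left C 0))
  rw [inv_mul_le_iff₀ h0] at h2
  linarith

theorem IsAnisotropy.exists_mul_norm_le (hσ : IsAnisotropy σ) :
    ∃ c, 0 < c ∧ ∀ p, c * ‖p‖ ≤ σ p := by
  rcases (Metric.sphere (0 : EuclideanSpace ℝ (Fin n)) 1).eq_empty_or_nonempty with he | hne
  · refine ⟨1, one_pos, fun p => ?_⟩
    rcases eq_or_ne p 0 with rfl | hp
    · simp [hσ.map_zero]
    · have : ‖p‖⁻¹ • p ∈ Metric.sphere (0 : EuclideanSpace ℝ (Fin n)) 1 := by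
        simp [norm_smul, hp]
      simp [he] at this
  obtain ⟨x, hx, hmin⟩ := (isCompact_sphere (0 : EuclideanSpace ℝ (Fin n)) 1).exists_isMinOn hne
    hσ.continuous.continuousOn
  have hx0 : x ≠ 0 := by rintro rfl; simp at hx
  refine ⟨σ x, hσ.pos x hx0, fun p => ?_⟩
  rcases eq_or_ne p 0 with rfl | hp
  · simp [hσ.map_zero]
  have h0 : 0 < ‖p‖ := norm_pos_iff.2 hp
  have h1 : σ x ≤ σ (‖p‖⁻¹ • p) := hmin (by simp [norm_smul, h0.ne'])
  rw [hσ.pos_homogeneous _ _ (inv_pos.2 h0), le_inv_mul_iff₀ h0] at h1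
  linarith

/-- The unit ball of the polar of `σ` consists of the linear minorants of `σ`. -/
theorem IsAnisotropy.polarAnisotropy_le_one_iff (hσ : IsAnisotropy σ)
    {q : EuclideanSpace ℝ (Fin n)} : polarAnisotropy σ q ≤ 1 ↔ ∀ p, inner ℝ q p ≤ σ p := by
  obtain ⟨c, hc, hcσ⟩ := hσ.exists_mul_norm_le
  constructor
  · intro h p
    rcases eq_or_ne p 0 with rfl | hp
    · simp [hσ.map_zero]
    have hpos := hσ.pos p hp
    -- Boundedness is essential: the real `sSup` of an unbounded set is `0`.
    have hbdd : BddAbove ((fun p => inner ℝ q p) '' {p | σ p ≤ 1}) := by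
      refine ⟨‖q‖ * c⁻¹, ?_⟩
      rintro _ ⟨p, hp : σ p ≤ 1, rfl⟩
      refine (real_inner_le_norm q p).trans ?_
      gcongr
      rw [← one_div, le_div_iff₀ hc, mul_comm]
      exact (hcσ p).trans hp
    have h1 := le_csSup hbdd ⟨(σ p)⁻¹ • p, by
      simp [hσ.pos_homogeneous _ _ (inv_pos.2 hpos), hpos.ne'], rfl⟩
    have h2 := h1.trans h
    simp only [inner_smul_right] at h2
    rwa [inv_mul_le_iff₀ hpos, mul_one] at h2
  · intro h
    refine csSup_le ⟨_, 0, by simp [hσ.map_zero], rfl⟩ ?_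
    rintro _ ⟨p, hp, rfl⟩
    exact (h p).trans hp

/-- Testing the subgradient inequality at `2p` and at `0` gives opposite inequalities, hence `q · p
= σ p`. The inequality then reduces to `q · w ≤ σ w`. -/
theorem IsAnisotropy.mem_subdifferential_iff (hσ : IsAnisotropy σ)
    {p q : EuclideanSpace ℝ (Fin n)} :
    q ∈ subdifferential (fun p => (σ p : EReal)) p ↔
      (∀ w, inner ℝ q w ≤ σ w) ∧ inner ℝ q p = σ p := by
  simp only [subdifferential, Set.mem_ofPred_eq]
  constructor
  · intro h
    have h' : ∀ w, σ p + inner ℝ q (w - p) ≤ σ w := fun w => by exact_mod_cast h w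
    have h2 := h' ((2 : ℝ) • p)
    have h0 := h' 0
    rw [hσ.pos_homogeneous 2 p two_pos, inner_sub_right, inner_smul_right] at h2
    rw [hσ.map_zero, zero_sub, inner_neg_right] at h0
    have he : inner ℝ q p = σ p := by linarith
    refine ⟨fun w => ?_, he⟩
    have := h' w
    rw [inner_sub_right] at this
    linarith
  · rintro ⟨h1, h2⟩ w
    have : σ p + inner ℝ q (w - p) ≤ σ w := by
      rw [inner_sub_right]
      linarith [h1 w]
    exact_mod_cast this

/-- Hahn–Banach: the functional `a p ↦ a σ(p)` on the line through `p` is dominated by `σ`,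
trivially for `a ≤ 0` because `σ ≥ 0`. -/
theorem IsAnisotropy.exists_inner_eq (hσ : IsAnisotropy σ) (p : EuclideanSpace ℝ (Fin n)) :
    ∃ q : EuclideanSpace ℝ (Fin n), (∀ w, inner ℝ q w ≤ σ w) ∧ inner ℝ q p = σ p := by
  rcases eq_or_ne p 0 with rfl | hp
  · exact ⟨0, fun w => by simpa using hσ.nonneg w, by simp [hσ.map_zero]⟩
  obtain ⟨g, hg, hgσ⟩ := exists_extension_of_le_sublinear
    (LinearPMap.mkSpanSingleton (K := ℝ) p (σ p) hp) σ
    (fun c hc x => hσ.pos_homogeneous c x hc) hσ.add_le (by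
      rintro ⟨x, hx⟩
      obtain ⟨a, rfl⟩ := Submodule.mem_span_singleton.1 hx
      refine (LinearPMap.mkSpanSingleton'_apply p (σ p) _ a hx).trans_le ?_
      rw [smul_eq_mul]
      rcases lt_trichotomy a 0 with ha | rfl | ha
      · exact (mul_nonpos_of_nonpos_of_nonneg ha.le (hσ.nonneg p)).trans (hσ.nonneg _)
      · simp [hσ.map_zero]
      · rw [hσ.pos_homogeneous a p ha, RingHom.id_apply])
  refine ⟨(InnerProductSpace.toDual ℝ _).symm (LinearMap.toContinuousLinearMap g),
    fun w => by simpa using hgσ w, ?_⟩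
  have h1 := hg ⟨p, Submodule.mem_span_singleton_self p⟩
  have h2 := LinearPMap.mkSpanSingleton_apply ℝ ℝ (σ := RingHom.id ℝ) hp (σ p)
  simpa using h1.trans h2

/-- Linear minorants of `σ` are uniformly bounded. -/
theorem IsAnisotropy.exists_norm_le (hσ : IsAnisotropy σ) :
    ∃ C, 0 ≤ C ∧ ∀ q : EuclideanSpace ℝ (Fin n), (∀ w, inner ℝ q w ≤ σ w) → ‖q‖ ≤ C := by
  obtain ⟨C, hC, h⟩ := hσ.exists_le_mul_norm
  refine ⟨C, hC, fun q hq => ?_⟩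
  have h1 := (hq q).trans (h q)
  rw [real_inner_self_eq_norm_sq, sq] at h1
  rcases (norm_nonneg q).eq_or_lt with h0 | h0
  · rw [← h0]; exact hC
  · exact le_of_mul_le_mul_right h1 h0

end Anisotropy

/-! ### Approximate identities and weak convergence of mollifications -/

section ApproximateIdentity

variable {n : ℕ}

/-- A smooth nonnegative function on the torus with a unique maximum, at the origin. -/
noncomputable def torusPeak (t : UnitAddTorus (Fin n)) : ℝ :=
  1 + ∑ i, (1 + (fourier 1 (t i) : ℂ).re)

theorem continuous_torusPeak : Continuous (torusPeak (n := n)) := by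
  unfold torusPeak
  fun_prop

theorem torusContDiff_torusPeak : TorusContDiff ∞ (torusPeak (n := n)) := by
  have : (fun x : EuclideanSpace ℝ (Fin n) => torusPeak (torusProj x)) =
      fun x => 1 + ∑ i, (1 + Real.cos (2 * Real.pi * x i)) := by
    funext x
    simp only [torusPeak, torusProj]
    congr 1
    refine Finset.sum_congr rfl fun i _ => ?_
    rw [fourier_coe_apply, ← Complex.exp_ofReal_mul_I_re]
    push_cast
    congr 3
    ring
  unfold TorusContDiff
  rw [this]
  fun_prop

theorem re_fourier_one_lt {t : UnitAddCircle} (ht : t ≠ 0) : (fourier 1 t : ℂ).re < 1 := by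
  rw [fourier_one]
  have h1 : ‖(AddCircle.toCircle t : ℂ)‖ = 1 := Circle.norm_coe _
  refine lt_of_le_of_ne ((Complex.re_le_norm _).trans_eq h1) fun h => ht ?_
  have h2 : (AddCircle.toCircle t : ℂ) = 1 := by
    have h3 := Complex.sq_norm (AddCircle.toCircle t : ℂ)
    rw [h1, Complex.normSq_apply, h] at h3
    have h4 : (AddCircle.toCircle t : ℂ).im = 0 := by nlinarith
    exact Complex.ext (by simpa using h) (by simpa using h4)
  refine AddCircle.injective_toCircle one_ne_zero ?_
  rw [AddCircle.toCircle_zero]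
  exact Circle.ext (by simpa using h2)

theorem neg_one_le_re_fourier_one (t : UnitAddCircle) : -1 ≤ (fourier 1 t : ℂ).re := by
  rw [fourier_one]
  have h1 : ‖(AddCircle.toCircle t : ℂ)‖ = 1 := Circle.norm_coe _
  have := (abs_le.1 (Complex.abs_re_le_norm (AddCircle.toCircle t : ℂ))).1
  rwa [h1] at this

/-- The leading `1` of `torusPeak` keeps the powers of positive mass even for `n = 0`, where the sum
is empty. -/
theorem one_le_torusPeak (t : UnitAddTorus (Fin n)) : 1 ≤ torusPeak t := by
  have : 0 ≤ ∑ i, (1 + (fourier 1 (t i) : ℂ).re) :=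
    Finset.sum_nonneg fun i _ => by linarith [neg_one_le_re_fourier_one (t i)]
  unfold torusPeak
  linarith

theorem torusPeak_lt {t : UnitAddTorus (Fin n)} (ht : t ≠ 0) :
    torusPeak t < torusPeak (0 : UnitAddTorus (Fin n)) := by
  unfold torusPeak
  obtain ⟨i, hi⟩ := Function.ne_iff.1 ht
  have h0 : (fourier 1 (0 : UnitAddCircle) : ℂ).re = 1 := by simp
  have hle : ∀ s : UnitAddCircle, (fourier 1 s : ℂ).re ≤ 1 := fun s => by
    rcases eq_or_ne s 0 with rfl | hs
    · exact h0.le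
    · exact (re_fourier_one_lt hs).le
  refine add_lt_add_right (Finset.sum_lt_sum (fun j _ => ?_) ⟨i, Finset.mem_univ i, ?_⟩) _
  · rw [Pi.zero_apply, h0]
    linarith [hle (t j)]
  · rw [Pi.zero_apply, h0]
    linarith [re_fourier_one_lt hi]

/-- The torus carries a sequence of smooth nonnegative kernels of unit mass concentrating at `0`. -/
theorem exists_torus_mollifier : ∃ ρ : ℕ → UnitAddTorus (Fin n) → ℝ,
    (∀ k, TorusContDiff ∞ (ρ k)) ∧ (∀ k t, 0 ≤ ρ k t) ∧ (∀ k, ∫ t, ρ k t = 1) ∧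
      ∀ g : UnitAddTorus (Fin n) → ℝ, Continuous g →
        Tendsto (fun k => ∫ t, ρ k t * g t) atTop (𝓝 (g 0)) := by
  have hc := continuous_torusPeak (n := n)
  have hpos : ∀ k : ℕ, 0 < ∫ t : UnitAddTorus (Fin n), torusPeak t ^ k := fun k =>
    (hc.pow k).integral_pos_of_hasCompactSupport_nonneg_nonzero
      (HasCompactSupport.of_compactSpace _)
      (fun t => pow_nonneg (zero_le_one.trans (one_le_torusPeak t)) k)
      (x := 0) (pow_pos (zero_lt_one.trans_le (one_le_torusPeak 0)) k).ne'
  -- Normalized powers of a positive function concentrate at its unique maximum.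
  refine ⟨fun k t => (∫ t : UnitAddTorus (Fin n), torusPeak t ^ k)⁻¹ * torusPeak t ^ k,
    fun k => ?_, fun k t => ?_, fun k => ?_, fun g hg => ?_⟩
  · exact contDiff_const.mul (ContDiff.pow torusContDiff_torusPeak k)
  · exact mul_nonneg (inv_nonneg.2 (hpos k).le)
      (pow_nonneg (zero_le_one.trans (one_le_torusPeak t)) k)
  · rw [integral_const_mul, inv_mul_cancel₀ (hpos k).ne']
  · have := tendsto_setIntegral_pow_smul_of_unique_maximum_of_isCompact_of_continuousOn
      (μ := (volume : Measure (UnitAddTorus (Fin n)))) isCompact_univ hc.continuousOn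
      (x₀ := 0) (fun t _ ht => torusPeak_lt ht)
      (fun t _ => zero_le_one.trans (one_le_torusPeak t))
      (zero_lt_one.trans_le (one_le_torusPeak 0)) (by simp) hg.continuousOn
    simpa [integral_const_mul, mul_assoc] using this

variable {H : Type*} [NormedAddCommGroup H] [InnerProductSpace ℝ H]

/-- The correlation of two square integrable functions on the torus is continuous. -/
theorem continuous_integral_inner_translate {v w : UnitAddTorus (Fin n) → H}
    (hv : MemLp v 2) (hw : MemLp w 2) :
    Continuous fun h => ∫ x, inner ℝ (v (x + h)) (w x) := by
  -- Translations form a continuous family of measure-preserving maps, so they act continuously on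
  -- `L²`.
  let φ : C(UnitAddTorus (Fin n), C(UnitAddTorus (Fin n), UnitAddTorus (Fin n))) :=
    ContinuousMap.curry ⟨fun p : UnitAddTorus (Fin n) × UnitAddTorus (Fin n) => p.2 + p.1,
      by fun_prop⟩
  have hφ : ∀ h, MeasurePreserving (φ h) volume volume := fun h =>
    measurePreserving_add_right volume h
  have h1 : Continuous fun h => Lp.compMeasurePreserving (φ h) (hφ h) (hv.toLp v) :=
    continuous_const.compMeasurePreservingLp φ.continuous hφ (by simp)
  have h2 : (fun h => ∫ x, inner ℝ (v (x + h)) (w x)) =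
      fun h => inner ℝ (Lp.compMeasurePreserving (φ h) (hφ h) (hv.toLp v)) (hw.toLp w) := by
    funext h
    rw [L2.inner_def]
    refine integral_congr_ae ?_
    filter_upwards [Lp.coeFn_compMeasurePreserving (hv.toLp v) (hφ h),
      (hφ h).quasiMeasurePreserving.ae hv.coeFn_toLp, hw.coeFn_toLp] with x hx1 hx2 hx3
    rw [hx1, hx3, Function.comp_apply, hx2]
    rfl
  rw [h2]
  fun_prop

/-- The shear `(x, h) ↦ (x, x + h)` preserves the product measure and reduces the claim to a product
of integrable functions. This justifies Fubini for mollified pairings. -/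
theorem integrable_prod_inner_translate {v w : UnitAddTorus (Fin n) → H}
    (hv : MemLp v 2) (hw : MemLp w 2) :
    Integrable (fun p : UnitAddTorus (Fin n) × UnitAddTorus (Fin n) =>
      inner ℝ (v (p.1 + p.2)) (w p.1)) (volume.prod volume) := by
  have hv1 : Integrable v := hv.integrable one_le_two
  have hw1 : Integrable w := hw.integrable one_le_two
  have h1 : Integrable (fun p : UnitAddTorus (Fin n) × UnitAddTorus (Fin n) =>
      inner ℝ (v p.2) (w p.1)) (volume.prod volume) :=
    (hw1.norm.mul_prod hv1.norm).mono' (hv1.1.comp_snd.inner hw1.1.comp_fst)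
      (Eventually.of_forall fun p => (norm_inner_le_norm _ _).trans_eq (mul_comm _ _))
  exact (measurePreserving_prod_add volume volume).integrable_comp_of_integrable h1

/-- Mollified square integrable functions converge weakly. -/
theorem tendsto_integral_inner_torusMollify [CompleteSpace H]
    {ρ : ℕ → UnitAddTorus (Fin n) → ℝ} (hρ : ∀ k, Continuous (ρ k))
    (hlim : ∀ g : UnitAddTorus (Fin n) → ℝ, Continuous g →
        Tendsto (fun k => ∫ t, ρ k t * g t) atTop (𝓝 (g 0)))
    {v w : UnitAddTorus (Fin n) → H} (hv : MemLp v 2) (hw : MemLp w 2) :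
    Tendsto (fun k => ∫ x, inner ℝ (torusMollify (ρ k) v x) (w x)) atTop
      (𝓝 (∫ x, inner ℝ (v x) (w x))) := by
  -- By Fubini the pairing with a mollification is the `ρ k`-average of the correlation function,
  -- which tends to its value at `0`.
  have h := hlim _ (continuous_integral_inner_translate hv hw)
  simp only [add_zero] at h
  refine h.congr fun k => ?_
  obtain ⟨C, hC⟩ := isCompact_univ.exists_bound_of_continuousOn (hρ k).continuousOn
  have h1 : ∀ x, inner ℝ (torusMollify (ρ k) v x) (w x) =
      ∫ h, ρ k h * inner ℝ (v (x + h)) (w x) := fun x => by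
    have h2 : torusMollify (ρ k) v x = ∫ h, ρ k h • v (x + h) := by
      rw [torusMollify, ← integral_add_left_eq_self _ x]
      simp
    have h3 : Integrable fun h => ρ k h • v (x + h) :=
      ((hv.integrable one_le_two).comp_add_left x).bdd_smul C (hρ k).aestronglyMeasurable
        (Eventually.of_forall fun y => hC _ (Set.mem_univ _))
    rw [h2, real_inner_comm, ← integral_inner h3]
    simp [inner_smul_right, real_inner_comm]
  simp_rw [h1, ← integral_const_mul]
  rw [integral_integral_swap]
  have h4 : Integrable (fun p : UnitAddTorus (Fin n) × UnitAddTorus (Fin n) =>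
      ρ k p.2 * inner ℝ (v (p.1 + p.2)) (w p.1)) (volume.prod volume) :=
    (integrable_prod_inner_translate hv hw).bdd_mul (c := C)
      (Continuous.aestronglyMeasurable ((hρ k).comp continuous_snd))
      (Eventually.of_forall fun y => hC _ (Set.mem_univ _))
  exact h4.swap

/-- Averaging against a probability density preserves a closed half-space. Mollified fields thus
satisfy the polar constraint everywhere, although it was only known a.e. -/
theorem inner_torusMollify_le {ρ : UnitAddTorus (Fin n) → ℝ} (hρ : Continuous ρ)
    (hpos : ∀ t, 0 ≤ ρ t) (hone : ∫ t, ρ t = 1) [CompleteSpace H] {z : UnitAddTorus (Fin n) → H}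
    (hz : Integrable z) {p : H} {c : ℝ} (h : ∀ᵐ x, inner ℝ (z x) p ≤ c)
    (x : UnitAddTorus (Fin n)) : inner ℝ (torusMollify ρ z x) p ≤ c := by
  have hi := integrable_kernel_smul hρ hz x
  rw [torusMollify, real_inner_comm, ← integral_inner hi]
  have hone' : ∫ y, ρ (y - x) = 1 := by rw [integral_sub_right_eq_self (fun y => ρ y), hone]
  calc ∫ y, inner ℝ p (ρ (y - x) • z y) ≤ ∫ y, ρ (y - x) * c := by
        refine integral_mono_ae (hi.const_inner p) ?_ ?_
        · exact Continuous.integrable_torus (by fun_prop)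
        · filter_upwards [h] with y hy
          rw [inner_smul_right, real_inner_comm]
          exact mul_le_mul_of_nonneg_left hy (hpos _)
    _ = c := by rw [integral_mul_const, hone', one_mul]

end ApproximateIdentity

/-! ### The energy, its duality and its subgradients -/

section Energy

variable {n : ℕ} {σ : EuclideanSpace ℝ (Fin n) → ℝ}

theorem IsAnisotropy.anisotropicTV_le_iff (hσ : IsAnisotropy σ) {w : TorusL2 n} {M : EReal} :
    anisotropicTV σ w ≤ M ↔ ∀ z : UnitAddTorus (Fin n) → EuclideanSpace ℝ (Fin n),
      TorusContDiff 1 z → (∀ x p, inner ℝ (z x) p ≤ σ p) →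
        ((-∫ x, w x * torusDiv z x : ℝ) : EReal) ≤ M := by
  simp only [anisotropicTV, iSup_le_iff, Set.mem_ofPred_eq, and_imp, hσ.polarAnisotropy_le_one_iff]

theorem IsAnisotropy.le_anisotropicTV (hσ : IsAnisotropy σ) (w : TorusL2 n)
    {z : UnitAddTorus (Fin n) → EuclideanSpace ℝ (Fin n)}
    (hz : TorusContDiff 1 z) (hzσ : ∀ x p, inner ℝ (z x) p ≤ σ p) :
    ((-∫ x, w x * torusDiv z x : ℝ) : EReal) ≤ anisotropicTV σ w :=
  hσ.anisotropicTV_le_iff.1 le_rfl z hz hzσ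

theorem integral_toLp_mul_torusDiv {u : UnitAddTorus (Fin n) → ℝ} (hu2 : MemLp u 2)
    (z : UnitAddTorus (Fin n) → EuclideanSpace ℝ (Fin n)) :
    ∫ x, hu2.toLp u x * torusDiv z x = ∫ x, u x * torusDiv z x :=
  integral_congr_ae (hu2.coeFn_toLp.mono fun x hx => by simp only [hx])

/-- The distributional divergence identity may be tested with Lipschitz functions. -/
theorem IsNegDistribDiv.integral_mul_eq {v : UnitAddTorus (Fin n) → ℝ} (hv : MemLp v 2)
    {z : UnitAddTorus (Fin n) → EuclideanSpace ℝ (Fin n)} (hz : MemLp z ∞)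
    (h : IsNegDistribDiv v z) {u : UnitAddTorus (Fin n) → ℝ} {K : NNReal}
    (hu : LipschitzWith K fun x : EuclideanSpace ℝ (Fin n) => u (torusProj x)) :
    ∫ x, v x * u x = ∫ x, inner ℝ (z x) (torusGrad u x) := by
  obtain ⟨ρ, hρ, -, -, hlim⟩ := exists_torus_mollifier (n := n)
  have hρc := fun k => (hρ k).continuous
  have hu2 : MemLp u 2 := (continuous_of_continuous_lift hu.continuous).memLp_of_hasCompactSupport
    (HasCompactSupport.of_compactSpace u)
  have hz2 : MemLp z 2 := hz.mono_exponent le_top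
  have hzi := hz2.integrable one_le_two
  have h1 := tendsto_integral_inner_torusMollify hρc hlim hv hu2
  have h2 := tendsto_integral_inner_torusMollify hρc hlim hz2
    ((memLp_top_torusGrad hu).mono_exponent le_top)
  -- For the mollified field, which is `C¹` with divergence minus the mollified `v`, this is
  -- ordinary integration by parts.
  have h3 : ∀ k, ∫ x, inner ℝ (torusMollify (ρ k) v x) (u x) =
      ∫ x, inner ℝ (torusMollify (ρ k) z x) (torusGrad u x) := fun k => by
    rw [← neg_integral_mul_torusDiv hu (torusContDiff_torusMollify
      (ContDiff.of_le (hρ k) (by exact_mod_cast le_top)) hzi), ← integral_neg]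
    simp [torusDiv_torusMollify (hρ k) hzi h]
  simp_rw [h3] at h1
  have h4 := tendsto_nhds_unique h1 h2
  simpa [mul_comm] using h4

/-- A divergence of a bounded field with values in the polar ball is dominated by the energy. -/
theorem IsAnisotropy.integral_mul_le_anisotropicTV (hσ : IsAnisotropy σ)
    {v : UnitAddTorus (Fin n) → ℝ} (hv : MemLp v 2)
    {z : UnitAddTorus (Fin n) → EuclideanSpace ℝ (Fin n)} (hz : MemLp z ∞)
    (h : IsNegDistribDiv v z) (hzσ : ∀ᵐ x, ∀ p, inner ℝ (z x) p ≤ σ p) (w : TorusL2 n) :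
    ((∫ x, v x * w x : ℝ) : EReal) ≤ anisotropicTV σ w := by
  obtain ⟨ρ, hρ, hρ0, hρ1, hlim⟩ := exists_torus_mollifier (n := n)
  have hρc := fun k => (hρ k).continuous
  have hzi := hz.integrable le_top
  have h1 := tendsto_integral_inner_torusMollify hρc hlim hv (Lp.memLp w)
  have h2 : ∀ k, ((∫ x, inner ℝ (torusMollify (ρ k) v x) (w x) : ℝ) : EReal) ≤
      anisotropicTV σ w := fun k => by
    refine le_of_eq_of_le ?_ (hσ.le_anisotropicTV w (torusContDiff_torusMollify
      (ContDiff.of_le (hρ k) (by exact_mod_cast le_top)) hzi) fun x p =>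
        inner_torusMollify_le (hρc k) (hρ0 k) (hρ1 k) hzi (hzσ.mono fun x hx => hx p) x)
    rw [← integral_neg]
    simp [torusDiv_torusMollify (hρ k) hzi h]
  have h3 := le_of_tendsto' ((continuous_coe_real_ereal.tendsto _).comp h1) h2
  simpa [mul_comm] using h3

/-- Bounded measurable fields with values in the polar ball are admissible in the energy of a
Lipschitz function. -/
theorem IsAnisotropy.integral_inner_torusGrad_le (hσ : IsAnisotropy σ)
    {u : UnitAddTorus (Fin n) → ℝ} {K : NNReal}
    (hu : LipschitzWith K fun x : EuclideanSpace ℝ (Fin n) => u (torusProj x)) (hu2 : MemLp u 2)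
    {z : UnitAddTorus (Fin n) → EuclideanSpace ℝ (Fin n)} (hz : MemLp z ∞)
    (hzσ : ∀ᵐ x, ∀ p, inner ℝ (z x) p ≤ σ p) :
    ((∫ x, inner ℝ (z x) (torusGrad u x) : ℝ) : EReal) ≤ anisotropicTV σ (hu2.toLp u) := by
  obtain ⟨ρ, hρ, hρ0, hρ1, hlim⟩ := exists_torus_mollifier (n := n)
  have hρc := fun k => (hρ k).continuous
  have hz2 : MemLp z 2 := hz.mono_exponent le_top
  have hzi := hz2.integrable one_le_two
  have h1 := tendsto_integral_inner_torusMollify hρc hlim hz2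
    ((memLp_top_torusGrad hu).mono_exponent le_top)
  refine le_of_tendsto' ((continuous_coe_real_ereal.tendsto _).comp h1) fun k => ?_
  have hk := torusContDiff_torusMollify (ρ := ρ k)
      (ContDiff.of_le (hρ k) (by exact_mod_cast le_top)) hzi
  rw [Function.comp_apply, ← neg_integral_mul_torusDiv hu hk, ← integral_toLp_mul_torusDiv hu2]
  exact hσ.le_anisotropicTV _ hk fun x p =>
    inner_torusMollify_le (hρc k) (hρ0 k) (hρ1 k) hzi (hzσ.mono fun x hx => hx p) x

theorem integrable_inner_of_memLp_top
    {f g : UnitAddTorus (Fin n) → EuclideanSpace ℝ (Fin n)} (hf : MemLp f ∞) (hg : MemLp g ∞) :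
    Integrable fun x => inner ℝ (f x) (g x) := by
  have h := L2.integrable_inner (𝕜 := ℝ) ((hf.mono_exponent le_top : MemLp f 2).toLp f)
    ((hg.mono_exponent le_top : MemLp g 2).toLp g)
  refine h.congr ?_
  filter_upwards [(hf.mono_exponent le_top : MemLp f 2).coeFn_toLp,
    (hg.mono_exponent le_top : MemLp g 2).coeFn_toLp] with x h1 h2
  rw [h1, h2]

theorem Continuous.memLp_top_torus {F : Type*} [NormedAddCommGroup F]
    {f : UnitAddTorus (Fin n) → F} (hf : Continuous f) : MemLp f ∞ :=
  hf.memLp_of_hasCompactSupport (HasCompactSupport.of_compactSpace f)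

/-- A calibrating field yields a subgradient of the energy. -/
theorem IsAnisotropy.mem_subdifferential_anisotropicTV (hσ : IsAnisotropy σ)
    {u : UnitAddTorus (Fin n) → ℝ} {K : NNReal}
    (hu : LipschitzWith K fun x : EuclideanSpace ℝ (Fin n) => u (torusProj x)) (hu2 : MemLp u 2)
    {v : TorusL2 n} {z : UnitAddTorus (Fin n) → EuclideanSpace ℝ (Fin n)} (hz : MemLp z ∞)
    (h : IsNegDistribDiv v z)
    (hzσ : ∀ᵐ x, z x ∈ subdifferential (fun p => (σ p : EReal)) (torusGrad u x)) :
    v ∈ subdifferential (anisotropicTV σ) (hu2.toLp u) := by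
  simp only [hσ.mem_subdifferential_iff] at hzσ
  intro w
  have hin : ∀ f : TorusL2 n, inner ℝ v f = ∫ x, v x * f x := fun f => by
    simp [L2.inner_def, mul_comm]
  -- Any competitor obeys `ζ · ∇u ≤ σ(∇u) = z · ∇u` a.e., so `z` calibrates `u`.
  have h1 : anisotropicTV σ (hu2.toLp u) ≤ ((inner ℝ v (hu2.toLp u) : ℝ) : EReal) := by
    refine hσ.anisotropicTV_le_iff.2 fun ζ hζ hζσ => ?_
    rw [integral_toLp_mul_torusDiv, neg_integral_mul_torusDiv hu hζ, EReal.coe_le_coe_iff, hin]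
    have h2 : ∫ x, v x * hu2.toLp u x = ∫ x, v x * u x :=
      integral_congr_ae (hu2.coeFn_toLp.mono fun x hx => by simp only [hx])
    rw [h2, h.integral_mul_eq (Lp.memLp v) hz hu]
    refine integral_mono_ae
      (integrable_inner_of_memLp_top hζ.continuous.memLp_top_torus (memLp_top_torusGrad hu))
      (integrable_inner_of_memLp_top hz (memLp_top_torusGrad hu)) ?_
    filter_upwards [hzσ] with x hx
    rw [hx.2]
    exact hζσ x _
  have h3 := hσ.integral_mul_le_anisotropicTV (Lp.memLp v) hz h (hzσ.mono fun x hx => hx.1) w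
  rw [← hin] at h3
  refine le_trans ?_ h3
  refine (add_le_add_left h1 _).trans_eq ?_
  rw [← EReal.coe_add, inner_sub_right, add_sub_cancel]

/-- A bounded sequence in a Hilbert space has a weak limit along any ultrafilter. -/
theorem exists_weak_limit_of_bounded {ι H : Type*} [NormedAddCommGroup H] [InnerProductSpace ℝ H]
    [CompleteSpace H] (f : Ultrafilter ι) {x : ι → H} {B : ℝ} (hx : ∀ k, ‖x k‖ ≤ B) :
    ∃ y, ∀ w, Tendsto (fun k => inner ℝ (x k) w) f (𝓝 (inner ℝ y w)) := by
  -- Banach–Alaoglu transported by the Riesz isomorphism; an ultrafilter avoids extracting a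
  -- subsequence.
  have hc := WeakDual.isCompact_closedBall (𝕜 := ℝ) (E := H) 0 B
  let g : ι → WeakDual ℝ H := fun k =>
    StrongDual.toWeakDual (InnerProductSpace.toDual ℝ H (x k))
  obtain ⟨y, -, hy⟩ := hc.ultrafilter_le_nhds (f.map g) (by
    rw [le_principal_iff]
    refine Filter.Eventually.of_forall (p := fun k => g k ∈ _) fun k => ?_
    simpa [g] using hx k)
  refine ⟨(InnerProductSpace.toDual ℝ H).symm (WeakDual.toStrongDual y), fun w => ?_⟩
  have h1 : Tendsto g f (𝓝 y) := hy
  have h2 := ((WeakDual.eval_continuous w).tendsto y).comp h1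
  simpa [g, Function.comp_def] using h2

/-- A countable dense set of `p` needs only one null set, and continuity of `σ` reaches the
remaining `p`. -/
theorem ae_forall_inner_le (hσ : IsAnisotropy σ)
    {z : UnitAddTorus (Fin n) → EuclideanSpace ℝ (Fin n)}
    (h : ∀ p, ∀ᵐ x, inner ℝ (z x) p ≤ σ p) : ∀ᵐ x, ∀ p, inner ℝ (z x) p ≤ σ p := by
  have h1 := ae_all_iff.2 fun k : ℕ =>
    h (TopologicalSpace.denseSeq (EuclideanSpace ℝ (Fin n)) k)
  filter_upwards [h1] with x hx p
  have hσc := hσ.continuous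
  have hcl : IsClosed {p | inner ℝ (z x) p ≤ σ p} := isClosed_le (by fun_prop) hσc
  have h2 : closure (Set.range (TopologicalSpace.denseSeq (EuclideanSpace ℝ (Fin n)))) ⊆
      {p | inner ℝ (z x) p ≤ σ p} := hcl.closure_subset_iff.2 (by rintro _ ⟨k, rfl⟩; exact hx k)
  exact h2 (TopologicalSpace.denseRange_denseSeq (EuclideanSpace ℝ (Fin n)) p)

/-- The set of divergences of smooth fields with values in the polar ball. -/
def smoothDivergences (σ : EuclideanSpace ℝ (Fin n) → ℝ) : Set (TorusL2 n) :=
  {f | ∃ z : UnitAddTorus (Fin n) → EuclideanSpace ℝ (Fin n), TorusContDiff 1 z ∧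
    (∀ x p, inner ℝ (z x) p ≤ σ p) ∧ f =ᵐ[volume] fun x => -torusDiv z x}

theorem TorusContDiff.torusDiv_combination
    {z w : UnitAddTorus (Fin n) → EuclideanSpace ℝ (Fin n)}
    (hz : TorusContDiff 1 z) (hw : TorusContDiff 1 w) (a b : ℝ) (t : UnitAddTorus (Fin n)) :
    torusDiv (fun x => a • z x + b • w x) t = a * torusDiv z t + b * torusDiv w t := by
  obtain ⟨x, rfl⟩ := torusProj_surjective t
  have h1 := (ContDiff.differentiable hz one_ne_zero x).hasFDerivAt
  have h2 := (ContDiff.differentiable hw one_ne_zero x).hasFDerivAt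
  have h3 := ((h1.const_smul a).add (h2.const_smul b)).fderiv
  simp only [torusDiv, torusFDeriv_torusProj, Finset.mul_sum, ← Finset.sum_add_distrib]
  refine Finset.sum_congr rfl fun i _ => ?_
  have h4 : fderiv ℝ (fun y => a • z (torusProj y) + b • w (torusProj y)) x = _ := h3
  rw [h4]
  simp

theorem convex_smoothDivergences : Convex ℝ (smoothDivergences σ) := by
  rintro f ⟨z, hz, hzσ, hf⟩ g ⟨w, hw, hwσ, hg⟩ a b ha hb hab
  refine ⟨fun x => a • z x + b • w x, ?_, fun x p => ?_, ?_⟩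
  · exact (ContDiff.const_smul a hz).add (ContDiff.const_smul b hw)
  · rw [inner_add_left, real_inner_smul_left, real_inner_smul_left]
    calc a * inner ℝ (z x) p + b * inner ℝ (w x) p ≤ a * σ p + b * σ p := by
          gcongr
          · exact hzσ x p
          · exact hwσ x p
      _ = σ p := by rw [← add_mul, hab, one_mul]
  · filter_upwards [Lp.coeFn_add (a • f) (b • g), Lp.coeFn_smul a f, Lp.coeFn_smul b g, hf, hg]
      with x h1 h2 h3 h4 h5
    rw [h1, Pi.add_apply, h2, h3, Pi.smul_apply, Pi.smul_apply, h4, h5,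
      hz.torusDiv_combination hw]
    simp only [smul_eq_mul]
    ring

/-- The energy is the support function of `smoothDivergences σ`. If `v` were outside the closed
convex hull, a separating functional, represented by some `w`, would give `E(w) ≤ s < (v, w)`. -/
theorem mem_closure_smoothDivergences (hσ : IsAnisotropy σ) {v : TorusL2 n}
    (hv : ∀ w : TorusL2 n, ((inner ℝ v w : ℝ) : EReal) ≤ anisotropicTV σ w) :
    v ∈ closure (smoothDivergences σ) := by
  by_contra hcon
  obtain ⟨f, s, hfs, hsv⟩ := geometric_hahn_banach_closed_point
    (convex_smoothDivergences (σ := σ)).closure isClosed_closure hcon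
  set w := (InnerProductSpace.toDual ℝ (TorusL2 n)).symm f with hw
  have hf : ∀ g, f g = inner ℝ w g := fun g => by simp [hw]
  have h1 : anisotropicTV σ w ≤ (s : EReal) := by
    refine hσ.anisotropicTV_le_iff.2 fun z hz hzσ => ?_
    have hd : MemLp (fun x => -torusDiv z x) 2 (volume : Measure (UnitAddTorus (Fin n))) :=
      (hz.continuous_torusDiv.neg).memLp_of_hasCompactSupport
        (HasCompactSupport.of_compactSpace _)
    have h2 := (hfs _ (subset_closure ⟨z, hz, hzσ, hd.coeFn_toLp⟩)).le
    rw [EReal.coe_le_coe_iff]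
    refine le_of_eq_of_le ?_ h2
    rw [hf, L2.inner_def, ← integral_neg]
    refine integral_congr_ae (hd.coeFn_toLp.mono fun x hx => ?_)
    simp [hx, mul_comm]
  have h3 := (hv w).trans h1
  rw [EReal.coe_le_coe_iff, real_inner_comm, ← hf] at h3
  exact absurd hsv h3.not_gt

/-- Every `v` dominated by the energy is the divergence of a bounded field with values in the
polar ball. -/
theorem exists_field_of_le_anisotropicTV (hσ : IsAnisotropy σ) {v : TorusL2 n}
    (hv : ∀ w : TorusL2 n, ((inner ℝ v w : ℝ) : EReal) ≤ anisotropicTV σ w) :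
    ∃ z : UnitAddTorus (Fin n) → EuclideanSpace ℝ (Fin n), MemLp z ∞ ∧ IsNegDistribDiv v z ∧
      ∀ᵐ x, ∀ p, inner ℝ (z x) p ≤ σ p := by
  obtain ⟨f, hf, hfv⟩ := mem_closure_iff_seq_limit.1 (mem_closure_smoothDivergences hσ hv)
  choose z hz hzσ hfz using hf
  obtain ⟨R, hR, hRσ⟩ := hσ.exists_norm_le
  have hz2 : ∀ k, MemLp (z k) 2 (volume : Measure (UnitAddTorus (Fin n))) := fun k =>
    (hz k).continuous.memLp_of_hasCompactSupport (HasCompactSupport.of_compactSpace _)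
  have hU : (hyperfilter ℕ : Filter ℕ) ≤ atTop := Nat.hyperfilter_le_atTop
  obtain ⟨Z, hZ⟩ := exists_weak_limit_of_bounded (hyperfilter ℕ) (x := fun k => (hz2 k).toLp (z k))
    fun k => Lp.norm_le_of_ae_bound hR
      ((hz2 k).coeFn_toLp.mono fun x hx => by rw [hx]; exact hRσ _ (hzσ k x))
  have hZi : Integrable Z := (Lp.memLp Z).integrable one_le_two
  have hZσ : ∀ᵐ x, ∀ p, inner ℝ (Z x) p ≤ σ p := by
    refine ae_forall_inner_le hσ fun p => ?_
    refine ae_le_of_forall_setIntegral_le (hZi.inner_const p) (integrable_const _) fun s hs hμs => ?_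
    -- Weak convergence tested on `p` times an indicator carries the constraint to the limit in
    -- integrated form.
    have h1 := hZ (indicatorConstLp 2 hs hμs.ne p)
    have h2 : ∀ Y : Lp (EuclideanSpace ℝ (Fin n)) 2 (volume : Measure (UnitAddTorus (Fin n))),
        inner ℝ Y (indicatorConstLp 2 hs hμs.ne p) = ∫ x in s, inner ℝ (Y x) p := fun Y => by
      rw [real_inner_comm, L2.inner_indicatorConstLp_eq_setIntegral_inner]
      simp_rw [real_inner_comm]
    simp_rw [h2] at h1
    refine le_of_tendsto' h1 fun k => ?_
    refine integral_mono_ae ?_ (integrable_const _) ?_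
    · exact (((Lp.memLp _).integrable one_le_two).inner_const p).integrableOn
    · refine ae_restrict_of_ae ((hz2 k).coeFn_toLp.mono fun x hx => ?_)
      simp only [hx]
      exact hzσ k x p
  refine ⟨Z, ?_, fun φ hφ => ?_, hZσ⟩
  · exact memLp_top_of_bound (Lp.memLp Z).1 R (hZσ.mono fun x hx => hRσ _ hx)
  · have hφ1 : TorusContDiff 1 φ := ContDiff.of_le hφ (by exact_mod_cast le_top)
    obtain ⟨L, hL⟩ := hφ1.exists_lipschitzWith_lift
    have hφ2 : MemLp φ 2 (volume : Measure (UnitAddTorus (Fin n))) :=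
      hφ.continuous.memLp_of_hasCompactSupport (HasCompactSupport.of_compactSpace _)
    have hg2 : MemLp (torusGrad φ) 2 (volume : Measure (UnitAddTorus (Fin n))) :=
      (memLp_top_torusGrad hL).mono_exponent le_top
    have h1 : Tendsto (fun k => inner ℝ (f k) (hφ2.toLp φ)) (hyperfilter ℕ)
        (𝓝 (inner ℝ v (hφ2.toLp φ))) := (hfv.inner tendsto_const_nhds).mono_left hU
    have h2 := hZ (hg2.toLp _)
    -- Integration by parts for each `C¹` field turns its pairing with `∇φ` into one with `f k`,
    -- which converges strongly to `v`.
    have h3 : ∀ k, inner ℝ ((hz2 k).toLp (z k)) (hg2.toLp _) = inner ℝ (f k) (hφ2.toLp φ) :=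
      fun k => by
        rw [L2.inner_def, L2.inner_def]
        trans ∫ x, inner ℝ (z k x) (torusGrad φ x)
        · refine integral_congr_ae ?_
          filter_upwards [(hz2 k).coeFn_toLp, hg2.coeFn_toLp] with x hx1 hx2
          rw [hx1, hx2]
        · rw [← neg_integral_mul_torusDiv hL (hz k), ← integral_neg]
          refine integral_congr_ae ?_
          filter_upwards [hfz k, hφ2.coeFn_toLp] with x hx1 hx2
          rw [hx1, hx2]
          simp
    simp_rw [h3] at h2
    have h4 := tendsto_nhds_unique h1 h2
    rw [L2.inner_def, L2.inner_def] at h4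
    trans ∫ x, inner ℝ (v x) (hφ2.toLp φ x)
    · refine integral_congr_ae (hφ2.coeFn_toLp.mono fun x hx => ?_)
      simp [hx, mul_comm]
    · rw [h4]
      refine integral_congr_ae (hg2.coeFn_toLp.mono fun x hx => ?_)
      simp only [hx]

/-- A field attaining the energy of a Lipschitz function selects the subdifferential of `σ` along
its gradient. -/
theorem ae_mem_subdifferential_of_anisotropicTV_le (hσ : IsAnisotropy σ)
    {u : UnitAddTorus (Fin n) → ℝ} {K : NNReal}
    (hu : LipschitzWith K fun x : EuclideanSpace ℝ (Fin n) => u (torusProj x)) (hu2 : MemLp u 2)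
    {z : UnitAddTorus (Fin n) → EuclideanSpace ℝ (Fin n)} (hz : MemLp z ∞)
    (hzσ : ∀ᵐ x, ∀ p, inner ℝ (z x) p ≤ σ p)
    (hE : anisotropicTV σ (hu2.toLp u) ≤
      ((∫ x, inner ℝ (z x) (torusGrad u x) : ℝ) : EReal)) :
    ∀ᵐ x, z x ∈ subdifferential (fun p => (σ p : EReal)) (torusGrad u x) := by
  have hg := memLp_top_torusGrad hu
  have hq : ∀ q : {q : EuclideanSpace ℝ (Fin n) // ∀ w, inner ℝ q w ≤ σ w},
      ∀ᵐ x, inner ℝ q.1 (torusGrad u x) ≤ inner ℝ (z x) (torusGrad u x) := by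
    rintro ⟨q, hq⟩
    have hqi := integrable_inner_of_memLp_top (memLp_top_const q) hg
    have hzi := integrable_inner_of_memLp_top hz hg
    refine ae_le_of_forall_setIntegral_le hqi hzi fun s hs _ => ?_
    classical
    -- The competitor equals `q` on `s` and `z` elsewhere; comparing its integral with the energy
    -- leaves only the contribution of `s`.
    have hζ : MemLp (s.piecewise (fun _ => q) z) ∞ (volume : Measure (UnitAddTorus (Fin n))) :=
      MemLp.piecewise hs ((memLp_top_const q).restrict s) (hz.restrict sᶜ)
    have h1 := (hσ.integral_inner_torusGrad_le hu hu2 hζ (by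
      filter_upwards [hzσ] with x hx p
      by_cases hxs : x ∈ s
      · simpa [hxs] using hq p
      · simpa [hxs] using hx p)).trans hE
    rw [EReal.coe_le_coe_iff, ← integral_add_compl hs (integrable_inner_of_memLp_top hζ hg),
      ← integral_add_compl hs hzi,
      setIntegral_congr_fun (g := fun x => inner ℝ q (torusGrad u x)) hs
        (fun x hx => by simp [hx]),
      setIntegral_congr_fun (s := sᶜ) (g := fun x => inner ℝ (z x) (torusGrad u x)) hs.compl
        (fun x hx => by simp [Set.notMem_of_mem_compl hx])] at h1
    linarith
  have : Nonempty {q : EuclideanSpace ℝ (Fin n) // ∀ w, inner ℝ q w ≤ σ w} :=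
    ⟨⟨0, fun w => by simpa using hσ.nonneg w⟩⟩
  have h1 := ae_all_iff.2 fun k : ℕ => hq (TopologicalSpace.denseSeq _ k)
  filter_upwards [h1, hzσ] with x hx hxσ
  refine hσ.mem_subdifferential_iff.2 ⟨hxσ, le_antisymm (hxσ _) ?_⟩
  -- This maximizer depends on `x`, so it is reached by density from the countably many `q` already
  -- treated.
  obtain ⟨q, hqσ, hqe⟩ := hσ.exists_inner_eq (torusGrad u x)
  rw [← hqe]
  have hcl : IsClosed {q : {q : EuclideanSpace ℝ (Fin n) // ∀ w, inner ℝ q w ≤ σ w} |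
      inner ℝ q.1 (torusGrad u x) ≤ inner ℝ (z x) (torusGrad u x)} :=
    isClosed_le (by fun_prop) continuous_const
  have h2 := hcl.closure_subset_iff.2 (by
    rintro _ ⟨k, rfl⟩
    exact hx k : Set.range (TopologicalSpace.denseSeq _) ⊆ _)
  exact h2 (TopologicalSpace.denseRange_denseSeq
    {q : EuclideanSpace ℝ (Fin n) // ∀ w, inner ℝ q w ≤ σ w} ⟨q, hqσ⟩)

/-- After integration by parts the integrand is at most `R * K`, with `R` bounding the polar ball.
Finiteness allows `E(u)` to be treated as a real number. -/
theorem anisotropicTV_toLp_lt_top (hσ : IsAnisotropy σ)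
    {u : UnitAddTorus (Fin n) → ℝ} {K : NNReal}
    (hu : LipschitzWith K fun x : EuclideanSpace ℝ (Fin n) => u (torusProj x)) (hu2 : MemLp u 2) :
    anisotropicTV σ (hu2.toLp u) < ⊤ := by
  obtain ⟨R, hR, hRσ⟩ := hσ.exists_norm_le
  refine lt_of_le_of_lt (b := ((∫ _ : UnitAddTorus (Fin n), R * K : ℝ) : EReal)) ?_
    (EReal.coe_lt_top _)
  refine hσ.anisotropicTV_le_iff.2 fun z hz hzσ => ?_
  rw [integral_toLp_mul_torusDiv, neg_integral_mul_torusDiv hu hz, EReal.coe_le_coe_iff]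
  refine integral_mono (integrable_inner_of_memLp_top hz.continuous.memLp_top_torus
    (memLp_top_torusGrad hu)) (integrable_const _) fun x => ?_
  refine (real_inner_le_norm _ _).trans ?_
  exact mul_le_mul (hRσ _ (hzσ x)) (norm_torusGrad_le hu x) (norm_nonneg _) hR

theorem anisotropicTV_nonneg (hσ : IsAnisotropy σ) (w : TorusL2 n) : 0 ≤ anisotropicTV σ w := by
  have h := hσ.le_anisotropicTV w (z := fun _ => 0) contDiff_const
    (fun x p => by simpa using hσ.nonneg p)
  simpa [torusDiv, torusFDeriv] using h

/-- Subgradients of the (one-homogeneous) energy at points of finite energy. -/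
theorem inner_eq_of_mem_subdifferential_anisotropicTV (hσ : IsAnisotropy σ) {u v : TorusL2 n}
    (hfin : anisotropicTV σ u < ⊤) (hv : v ∈ subdifferential (anisotropicTV σ) u) :
    anisotropicTV σ u = ((inner ℝ v u : ℝ) : EReal) ∧
      ∀ w, ((inner ℝ v w : ℝ) : EReal) ≤ anisotropicTV σ w := by
  have hbot : anisotropicTV σ u ≠ ⊥ := ((anisotropicTV_nonneg hσ u).trans_lt' (by simp)).ne'
  lift anisotropicTV σ u to ℝ using ⟨hfin.ne, hbot⟩ with c hc
  have hv' : ∀ w, ((c + inner ℝ v (w - u) : ℝ) : EReal) ≤ anisotropicTV σ w := fun w => by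
    have := hv w
    rwa [← hc, ← EReal.coe_add] at this
  -- Comparison with `0` and with `2u` gives `E(u) ≤ (v, u)` and `(v, u) ≤ E(u)`.
  have h0 : anisotropicTV σ (0 : TorusL2 n) ≤ ((0 : ℝ) : EReal) := by
    refine hσ.anisotropicTV_le_iff.2 fun z hz hzσ => ?_
    simp
  have h2 : anisotropicTV σ ((2 : ℝ) • u) ≤ ((2 * c : ℝ) : EReal) := by
    refine hσ.anisotropicTV_le_iff.2 fun z hz hzσ => ?_
    have h3 := hσ.le_anisotropicTV u hz hzσ
    rw [← hc, EReal.coe_le_coe_iff] at h3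
    have : ∫ x, ((2 : ℝ) • u : TorusL2 n) x * torusDiv z x = ∫ x, 2 * (u x * torusDiv z x) :=
      integral_congr_ae ((Lp.coeFn_smul (2 : ℝ) u).mono fun x hx => by simp [hx, mul_assoc])
    rw [EReal.coe_le_coe_iff, this, integral_const_mul]
    linarith
  have h0' := (hv' 0).trans h0
  have h2' := (hv' _).trans h2
  rw [EReal.coe_le_coe_iff, inner_sub_right] at h0' h2'
  rw [inner_smul_right] at h2'
  rw [inner_zero_right] at h0'
  have hcu : c = inner ℝ v u := by linarith
  refine ⟨by rw [hcu], fun w => ?_⟩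
  have := hv' w
  rwa [inner_sub_right, hcu, add_sub_cancel] at this

end Energy

theorem mainTheorem2 (n : ℕ) (σ : EuclideanSpace ℝ (Fin n) → ℝ) (hσ : IsAnisotropy σ)
    (u : UnitAddTorus (Fin n) → ℝ) (K : NNReal) (hu : LipschitzWith K u) (v : TorusL2 n) :
    v ∈ subdifferential (anisotropicTV σ) (hu.memLp_torus.toLp u) ↔
      ∃ z : UnitAddTorus (Fin n) → EuclideanSpace ℝ (Fin n),
        MemLp z ∞ volume ∧ IsNegDistribDiv v z ∧
          ∀ᵐ x, z x ∈ subdifferential (fun p => (σ p : EReal)) (torusGrad u x) := by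
  constructor
  · intro hv
    obtain ⟨hE, hle⟩ := inner_eq_of_mem_subdifferential_anisotropicTV hσ
      (anisotropicTV_toLp_lt_top hσ hu.lift_torus hu.memLp_torus) hv
    obtain ⟨z, hz, hdiv, hzσ⟩ := exists_field_of_le_anisotropicTV hσ hle
    refine ⟨z, hz, hdiv, ae_mem_subdifferential_of_anisotropicTV_le hσ hu.lift_torus
      hu.memLp_torus hz hzσ (hE.trans ?_).le⟩
    -- Testing the divergence identity with the Lipschitz `u` itself turns `E(u) = (v, u)` into
    -- `E(u) = ∫ z · ∇u`.
    rw [← hdiv.integral_mul_eq (Lp.memLp v) hz hu.lift_torus, L2.inner_def]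
    congr 1
    refine integral_congr_ae (hu.memLp_torus.coeFn_toLp.mono fun x hx => ?_)
    simp [hx, mul_comm]
  · rintro ⟨z, hz, hdiv, hzσ⟩
    exact hσ.mem_subdifferential_anisotropicTV hu.lift_torus hu.memLp_torus hz hdiv hzσ
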